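/- Let $n\ge 0$ and let $\mathcal A=\bigoplus_{k\in\mathbb Z^n}\mathcal A^{(k)}$ be a unital complex $*$-algebra with a $\mathbb Z^n$-grading such that $(\mathcal A^{(k)})^*\subseteq\mathcal A^{(-k)}$ (equivalently, a comodule $*$-algebra over the Hopf $*$-algebra of the torus $\mathbb T^n$). Put $\delta_j(a)=k_ja$ for $a\in\mathcal A^{(k)}$, and let $\mathcal B=\mathcal A^{(0)}$ be the invariant subalgebra. A spectral triple $(\mathcal A,\mathcal H,D)$ is a unital $*$-representation of $\mathcal A$ by bounded operators on a complex Hilbert space $\mathcal H$ with a selfadjoint operator $D$ with compact resolvent such that every $a\in\mathcal A$ preserves $\mathrm{dom}\,D$ and has bounded commutator $[D,a]$. Let $(\mathcal A,\mathcal H,D,J)$ be an odd real spectral triple of $KR$-dimension $n+m$ ($m\in\mathbb Z$, $n+m$ odd): $J$ is antiunitary, $J^2=\epsilon$, $JD=\epsilon' DJ$ with $(\epsilon,\epsilon')=(+,-),(-,+),(-,-),(+,+)$ for $n+m\equiv 1,3,5,7 \pmod 8$, and $[a,Jb^*J^{-1}]=0$, $[[D,a],Jb^*J^{-1}]=0$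 for all $a,b\in\mathcal A$. Let it be $\mathbb T^n$-equivariant: there are given strongly commuting selfadjoint operators $\delta_1,\dots,\delta_n$ on $\mathcal H$, whose common domain $\bigcap_j\mathrm{dom}\,\delta_j$ is stable under $\mathcal A$, with $\delta_j(a\psi)=\delta_j(a)\psi+a\,\delta_j\psi$ there, $\delta_jJ+J\delta_j=0$, and with $D$ strongly commuting with each $\delta_j$. Let the triple be projectable, by means of a bounded operator $\Gamma=\Gamma^*$ with $\Gamma^2=1$ that commutes with $\mathcal A$ and with all $\delta_j$ and satisfies $J\Gamma=\Gamma J$ if $m\equiv 0\pmod 4$ and $J\Gamma=-\Gamma J$ otherwise. Define the horizontal Dirac operator, on the domain $\{\psi\in\mathrm{dom}\,D:\Gamma\psi\in\mathrm{dom}\,D\}$, by $$D_h=\tfrac12\Gamma\big(\Gamma D+(-1)^nD\Gamma\big),$$ that is, $D_h=\tfrac12\Gamma[\Gamma,D]_-$ for $n$ odd and $D_h=\tfrac12\Gamma[\Gamma,D]_+$ for $n$ even. Let $\mathcal H_0=\bigcap_j\ker\delta_j$. Assume that the fibres are isometric: there are an operator $D_v$ on $\mathcal H$ and bounded operators $Z,Z'$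 on $\mathcal H$, with $Z'$ selfadjoint, such that $D=D_v+D_h+Z$ as unbounded operators (with equality of domains), $D_v$ vanishes on $\mathcal H_0\cap\mathrm{dom}\,D_v$, $D_v\Gamma=(-1)^{n+1}\Gamma D_v$ on $\mathrm{dom}\,D_v$ (which $\Gamma$ preserves), $D_v$ commutes with each $\delta_j$ (that is, with its resolvents), $Z$ commutes with $\mathcal A$, and $Ja^*J^{-1}Z=Z'Ja^*J^{-1}$ for all $a\in\mathcal A$. Then the restrictions of $\mathcal B$, of $D_h$ and of $J$ to the Hilbert space $\mathcal H_0$ are well defined: $\mathcal B$ and $J$ preserve $\mathcal H_0$, and $D_h$ maps $\mathcal H_0\cap\mathrm{dom}\,D_h$ into $\mathcal H_0$. Let $D_0$, with domain $\mathcal H_0\cap\mathrm{dom}\,D_h$, be the restriction of $D_h$, and $J_0$ (an antiunitary operator on $\mathcal H_0$) that of $J$. Then $(\mathcal B,\mathcal H_0,D_0)$ is a spectral triple. Moreover $b^\circ h=J_0b^*J_0^{-1}h$ defines a $*$-representation of the opposite algebra $\mathcal B^\circ$ (a right action $hb$ of $\mathcal B$) on $\mathcal H_0$, and for all $b,c\in\mathcal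 B$: (a) $[b,J_0c^*J_0^{-1}]=0$, that is, $J_0$ maps $\mathcal B$ into its commutant; (b) $[[D_0,b],J_0c^*J_0^{-1}]=0$ (first-order condition). -/

import Mathlib

open scoped InnerProductSpace ComplexConjugate

noncomputable section

namespace TorusBundle

/-! ### Unbounded operators -/

section Operators

variable {H : Type*} [NormedAddCommGroup H] [InnerProductSpace ℂ H]

/-- The bounded operator `R` is the inverse of `T - z : dom T → H`. -/
def IsResolventAt (T : H →ₗ.[ℂ] H) (z : ℂ) (R : H →L[ℂ] H) : Prop :=
  (∀ x : H, ∃ h : R x ∈ T.domain, T ⟨R x, h⟩ - z • R x = x) ∧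
    ∀ y : T.domain, R (T y - z • (y : H)) = y

/-- `(T - z)⁻¹` exists and is a compact operator, for every non-real `z`. -/
def HasCompactResolvent (T : H →ₗ.[ℂ] H) : Prop :=
  ∀ z : ℂ, z.im ≠ 0 → ∃ R : H →L[ℂ] H, IsResolventAt T z R ∧ IsCompactOperator R

/-- The bounded operator `S` preserves `dom T`, and the bounded operator `X` agrees with the
commutator `T S - S T` on `dom T`.  If `T` is densely defined, `X` is unique, and it is the
operator denoted by `[T, S]`. -/
def IsCommutator (T : H →ₗ.[ℂ] H) (S X : H →L[ℂ] H) : Prop :=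
  ∀ ψ : T.domain, ∃ h : S ψ ∈ T.domain, X ψ = T ⟨S ψ, h⟩ - S (T ψ)

/-- `S T ⊆ c T S`: the bounded operator `S` preserves `dom T`, and `T S = c S T` on `dom T`.
For `c = 1` the operators commute, for `c = -1` they anticommute. -/
def CommutesUpTo (c : ℂ) (T : H →ₗ.[ℂ] H) (S : H →L[ℂ] H) : Prop :=
  ∀ ψ : T.domain, ∃ h : S ψ ∈ T.domain, T ⟨S ψ, h⟩ = c • S (T ψ)

/-- An operator `T` commutes with a self-adjoint operator `S` if it commutes with the resolvents
`(S - z)⁻¹`.  If `T` is self-adjoint as well, this is the usual (strong) commutation of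
self-adjoint operators, that is, commutation of their spectral projections. -/
def StronglyCommutes (T S : H →ₗ.[ℂ] H) : Prop :=
  ∀ (z : ℂ) (R : H →L[ℂ] H), z.im ≠ 0 → IsResolventAt S z R → CommutesUpTo 1 T R

/-- `T₀` is the restriction of `T` to the subspace `K`: its domain is `K ∩ dom T`, on which `T`
takes values in `K`. -/
def IsRestriction (K : Submodule ℂ H) (T : H →ₗ.[ℂ] H) (T₀ : K →ₗ.[ℂ] K) : Prop :=
  (∀ h : K, h ∈ T₀.domain ↔ (h : H) ∈ T.domain) ∧
    ∀ (h : T₀.domain) (h' : ((h : K) : H) ∈ T.domain), (T₀ h : H) = T ⟨((h : K) : H), h'⟩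

/-- The kernel of an unbounded operator, as a subspace of the whole space. -/
def kernel (T : H →ₗ.[ℂ] H) : Submodule ℂ H where
  carrier := {ψ | ∃ h : ψ ∈ T.domain, T ⟨ψ, h⟩ = 0}
  zero_mem' := ⟨T.domain.zero_mem, T.map_zero⟩
  add_mem' := by
    rintro x y ⟨hx, hx'⟩ ⟨hy, hy'⟩
    refine ⟨T.domain.add_mem hx hy, ?_⟩
    have := T.map_add ⟨x, hx⟩ ⟨y, hy⟩
    rw [hx', hy', add_zero] at this
    exact this
  smul_mem' := by
    rintro c x ⟨hx, hx'⟩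
    refine ⟨T.domain.smul_mem c hx, ?_⟩
    have := T.map_smul c ⟨x, hx⟩
    rw [hx', smul_zero] at this
    exact this

theorem isClosed_kernel [CompleteSpace H] {T : H →ₗ.[ℂ] H} (hT : IsSelfAdjoint T) :
    IsClosed (kernel T : Set H) := by
  have hd := hT.dense_domain
  have hadj : T.adjoint = T := hT
  have key : (kernel T : Set H) = ⋂ x : T.domain, {ψ : H | inner ℂ ψ (T x) = 0} := by
    ext ψ
    simp only [Set.mem_iInter, Set.mem_ofPred_eq]
    constructor
    · rintro ⟨h, h0⟩ x
      have hf : T.IsFormalAdjoint T := by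
        have := LinearPMap.adjoint_isFormalAdjoint hd
        rwa [hadj] at this
      have := hf ⟨ψ, h⟩ x
      rw [h0, inner_zero_left] at this
      exact this.symm
    · intro h
      have h1 : ψ ∈ T.adjoint.domain :=
        LinearPMap.mem_adjoint_domain_of_exists ψ ⟨0, fun x => by rw [inner_zero_left, h x]⟩
      have h2 : T.adjoint ⟨ψ, h1⟩ = 0 :=
        LinearPMap.adjoint_apply_eq hd ⟨ψ, h1⟩ (fun x => by rw [inner_zero_left, h x])
      have h3 : ψ ∈ kernel T.adjoint := ⟨h1, h2⟩
      rw [hadj] at h3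
      exact h3
  rw [key]
  exact isClosed_iInter fun x => isClosed_eq (by fun_prop) continuous_const

end Operators

/-! ### Real spectral triples -/

section Triples

variable {A : Type*} [Ring A] [StarRing A] [Algebra ℂ A]
variable {H : Type*} [NormedAddCommGroup H] [InnerProductSpace ℂ H] [CompleteSpace H]

variable (A H) in
/-- A spectral triple `(A, H, D)` over a unital complex `*`-algebra `A`, represented on the
Hilbert space `H` by bounded operators. -/
structure SpectralTriple where
  /-- the representation of the algebra -/
  π : A →⋆ₐ[ℂ] (H →L[ℂ] H)
  /-- the Dirac operator -/
  D : H →ₗ.[ℂ] H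
  isSelfAdjoint : IsSelfAdjoint D
  hasCompactResolvent : HasCompactResolvent D
  /-- all commutators `[D, a]` are bounded -/
  bounded_commutator : ∀ a : A, ∃ X : H →L[ℂ] H, IsCommutator D (π a) X

/-- The operator `J b* J⁻¹`. -/
def oppositeAction (π : A →⋆ₐ[ℂ] (H →L[ℂ] H)) (J : H ≃ₗᵢ⋆[ℂ] H) (b : A) : H →L[ℂ] H :=
  (J.toContinuousLinearEquiv : H →SL[conj] H).comp
    ((π (star b)).comp (J.symm.toContinuousLinearEquiv : H →SL[conj] H))

@[simp]
theorem oppositeAction_apply (π : A →⋆ₐ[ℂ] (H →L[ℂ] H)) (J : H ≃ₗᵢ⋆[ℂ] H) (b : A) (ψ : H) :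
    oppositeAction π J b ψ = J (π (star b) (J.symm ψ)) := rfl

/-- The sign `ε` in `J² = ε` for odd `KR`-dimension `d`. -/
def signJSq (d : ℤ) : ℂ := if d ≡ 1 [ZMOD 8] ∨ d ≡ 7 [ZMOD 8] then 1 else -1

/-- The sign `ε'` in `J D = ε' D J` for odd `KR`-dimension `d`. -/
def signJD (d : ℤ) : ℂ := if d ≡ 3 [ZMOD 8] ∨ d ≡ 7 [ZMOD 8] then 1 else -1

variable (A H) in
/-- An odd real spectral triple `(A, H, D, J)` of `KR`-dimension `d`. -/
structure OddRealSpectralTriple (d : ℤ) extends SpectralTriple A H where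
  odd_dim : Odd d
  /-- the real structure -/
  J : H ≃ₗᵢ⋆[ℂ] H
  J_sq : ∀ ψ : H, J (J ψ) = signJSq d • ψ
  J_D : ∀ ψ : D.domain, ∃ h : J ψ ∈ D.domain, J (D ψ) = signJD d • D ⟨J ψ, h⟩
  /-- the adjoint action of `J` maps the algebra into its commutant -/
  commutant : ∀ a b : A, Commute (π a) (oppositeAction π J b)
  /-- `[[D, a], J b* J⁻¹] = 0` -/
  first_order : ∀ (a b : A) (X : H →L[ℂ] H), IsCommutator D (π a) X →
    Commute X (oppositeAction π J b)

end Triples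

/-! ### Torus actions -/

section Grading

variable {A : Type*} [Ring A] [Algebra ℂ A] {n : ℕ}

/-- A `ℤⁿ`-grading of a `*`-algebra is compatible with the involution if `*` maps the part of
degree `k` into the part of degree `-k`.  A `ℤⁿ`-graded `*`-algebra of this kind is the same as a
comodule `*`-algebra over the Hopf `*`-algebra of the torus `Tⁿ`, the part of degree `k` being
`{a | Δ a = a ⊗ z ^ k}`. -/
class StarCompatible [StarRing A] (𝒜 : (Fin n → ℤ) → Submodule ℂ A) : Prop where
  star_mem : ∀ {k : Fin n → ℤ} {a : A}, a ∈ 𝒜 k → star a ∈ 𝒜 (-k)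

variable (𝒜 : (Fin n → ℤ) → Submodule ℂ A) [GradedAlgebra 𝒜]

/-- The derivation `δ_j` of the algebra: multiplication by `k j` in degree `k`. -/
def derivation (j : Fin n) : A →ₗ[ℂ] A :=
  (DirectSum.toModule ℂ (Fin n → ℤ) A fun k => ((k j : ℤ) : ℂ) • (𝒜 k).subtype).comp
    (DirectSum.decomposeLinearEquiv 𝒜).toLinearMap

theorem derivation_of_mem (j : Fin n) {k : Fin n → ℤ} {a : A} (ha : a ∈ 𝒜 k) :
    derivation 𝒜 j a = ((k j : ℤ) : ℂ) • a := by
  simp only [derivation, LinearMap.comp_apply, LinearEquiv.coe_coe,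
    DirectSum.decomposeLinearEquiv_apply, DirectSum.decompose_of_mem 𝒜 ha]
  erw [DirectSum.toModule_lof]
  simp

/-- The invariant subalgebra `B`, that is, the part of degree `0`. -/
def invariantSubalgebra [StarRing A] [StarModule ℂ A] [StarCompatible 𝒜] : StarSubalgebra ℂ A where
  carrier := 𝒜 0
  mul_mem' {a b} ha hb := by
    have := SetLike.mul_mem_graded (A := 𝒜) ha hb
    rwa [add_zero] at this
  add_mem' ha hb := (𝒜 0).add_mem ha hb
  algebraMap_mem' r := SetLike.algebraMap_mem_graded 𝒜 r
  star_mem' {a} ha := by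
    have : star a ∈ 𝒜 (-0) := StarCompatible.star_mem ha
    rwa [neg_zero] at this

end Grading

section Equivariant

variable {A : Type*} [Ring A] [StarRing A] [Algebra ℂ A] {n : ℕ}
variable (𝒜 : (Fin n → ℤ) → Submodule ℂ A) [GradedAlgebra 𝒜]
variable (H : Type*) [NormedAddCommGroup H] [InnerProductSpace ℂ H] [CompleteSpace H]

/-- An odd `Tⁿ`-equivariant real spectral triple `(A, H, D, J, δ)` of `KR`-dimension `d`. -/
structure EquivariantTriple (d : ℤ) extends OddRealSpectralTriple A H d where
  /-- the generators of the torus action on the Hilbert space -/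
  δ : Fin n → (H →ₗ.[ℂ] H)
  δ_isSelfAdjoint : ∀ j, IsSelfAdjoint (δ j)
  δ_commute : ∀ i j, StronglyCommutes (δ i) (δ j)
  /-- the common domain of the `δ j` is stable under the algebra, and
  `δ_j (a ψ) = δ_j(a) ψ + a δ_j(ψ)` on it -/
  δ_leibniz : ∀ (a : A) (ψ : H) (hψ : ∀ i, ψ ∈ (δ i).domain) (j : Fin n),
    ∃ h : π a ψ ∈ (δ j).domain,
      δ j ⟨π a ψ, h⟩ = π (derivation 𝒜 j a) ψ + π a (δ j ⟨ψ, hψ j⟩)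
  δ_J : ∀ (j : Fin n) (ψ : (δ j).domain), ∃ h : J ψ ∈ (δ j).domain,
    δ j ⟨J ψ, h⟩ + J (δ j ψ) = 0
  δ_D : ∀ j, StronglyCommutes D (δ j)

namespace EquivariantTriple

variable {𝒜 H} {d : ℤ} (T : EquivariantTriple 𝒜 H d)

/-- The common `0`-eigenspace `H₀` of the operators `δ j`. -/
def zeroEigenspace : Submodule ℂ H := ⨅ j, kernel (T.δ j)

theorem isClosed_zeroEigenspace : IsClosed (T.zeroEigenspace : Set H) := by
  rw [zeroEigenspace, Submodule.coe_iInf]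
  exact isClosed_iInter fun j => isClosed_kernel (T.δ_isSelfAdjoint j)

instance : CompleteSpace T.zeroEigenspace :=
  T.isClosed_zeroEigenspace.completeSpace_coe

end EquivariantTriple

/-! ### Projectability and isometric fibres -/

variable {H}

/-- `½ Γ (Γ D + (-1)ⁿ D Γ)` on its natural domain `{ψ ∈ dom D | Γ ψ ∈ dom D}`.  For `Γ² = 1` it
is the part of `D` that anticommutes (`n` odd) or commutes (`n` even) with `Γ`. -/
def horizontalOperator (n : ℕ) (D : H →ₗ.[ℂ] H) (Γ : H →L[ℂ] H) : H →ₗ.[ℂ] H where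
  domain := D.domain ⊓ D.domain.comap (Γ : H →ₗ[ℂ] H)
  toFun :=
    { toFun := fun ψ => (1 / 2 : ℂ) •
        Γ (Γ (D ⟨(ψ : H), ψ.2.1⟩) + (-1 : ℂ) ^ n • D ⟨Γ (ψ : H), ψ.2.2⟩)
      map_add' := fun x y => by
        have h1 := D.map_add ⟨(x : H), x.2.1⟩ ⟨(y : H), y.2.1⟩
        have h2 := D.map_add ⟨Γ (x : H), x.2.2⟩ ⟨Γ (y : H), y.2.2⟩
        have h3 : D ⟨((x + y : ↥(D.domain ⊓ D.domain.comap (Γ : H →ₗ[ℂ] H))) : H), (x + y).2.1⟩ =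
            D ⟨(x : H), x.2.1⟩ + D ⟨(y : H), y.2.1⟩ := h1
        have h4 : D ⟨Γ ((x + y : ↥(D.domain ⊓ D.domain.comap (Γ : H →ₗ[ℂ] H))) : H),
            (x + y).2.2⟩ = D ⟨Γ (x : H), x.2.2⟩ + D ⟨Γ (y : H), y.2.2⟩ := by
          rw [← h2]
          congr 1
          exact Subtype.ext (map_add Γ _ _)
        rw [h3, h4]
        simp only [map_add, smul_add]
        abel
      map_smul' := fun c x => by
        have h1 := D.map_smul c ⟨(x : H), x.2.1⟩
        have h2 := D.map_smul c ⟨Γ (x : H), x.2.2⟩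
        have h3 : D ⟨((c • x : ↥(D.domain ⊓ D.domain.comap (Γ : H →ₗ[ℂ] H))) : H), (c • x).2.1⟩ =
            c • D ⟨(x : H), x.2.1⟩ := h1
        have h4 : D ⟨Γ ((c • x : ↥(D.domain ⊓ D.domain.comap (Γ : H →ₗ[ℂ] H))) : H),
            (c • x).2.2⟩ = c • D ⟨Γ (x : H), x.2.2⟩ := by
          rw [← h2]
          congr 1
          exact Subtype.ext (map_smul Γ _ _)
        rw [h3, h4]
        simp only [map_add, map_smul, RingHom.id_apply, smul_add, smul_comm c] }

variable {𝒜}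

/-- `Γ` makes the triple, of `KR`-dimension `n + m`, projectable along the fibres. -/
structure IsProjectable {m : ℤ} (T : EquivariantTriple 𝒜 H (n + m)) (Γ : H →L[ℂ] H) : Prop where
  sq : Γ * Γ = 1
  isSelfAdjoint : IsSelfAdjoint Γ
  comm_algebra : ∀ a : A, Commute Γ (T.π a)
  comm_δ : ∀ j : Fin n, CommutesUpTo 1 (T.δ j) Γ
  J_comm : m ≡ 0 [ZMOD 4] → ∀ ψ : H, T.J (Γ ψ) = Γ (T.J ψ)
  J_anticomm : ¬ m ≡ 0 [ZMOD 4] → ∀ ψ : H, T.J (Γ ψ) = -Γ (T.J ψ)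

/-- The horizontal Dirac operator `D_h`. -/
def EquivariantTriple.horizontalDirac {d : ℤ} (T : EquivariantTriple 𝒜 H d) (Γ : H →L[ℂ] H) :
    H →ₗ.[ℂ] H :=
  horizontalOperator n T.D Γ

/-- The isometric fibres condition: `D = D_v + D_h + Z` (an equality of unbounded operators, with
the natural domain of the sum), where `D_v`, `Z` and `Z'` have the listed properties. -/
def HasIsometricFibres {d : ℤ} (T : EquivariantTriple 𝒜 H d) (Γ : H →L[ℂ] H) : Prop :=
  ∃ (Dv : H →ₗ.[ℂ] H) (Z Z' : H →L[ℂ] H),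
    T.D = Dv + T.horizontalDirac Γ + (Z : H →ₗ[ℂ] H).toPMap ⊤ ∧
    (∀ ψ : Dv.domain, (ψ : H) ∈ T.zeroEigenspace → Dv ψ = 0) ∧
    CommutesUpTo ((-1) ^ (n + 1)) Dv Γ ∧
    (∀ j, StronglyCommutes Dv (T.δ j)) ∧
    (∀ a : A, Commute Z (T.π a)) ∧
    IsSelfAdjoint Z' ∧
    ∀ (a : A) (ψ : H), oppositeAction T.π T.J a (Z ψ) = Z' (oppositeAction T.π T.J a ψ)

end Equivariant

end TorusBundle

end

noncomputable section

namespace TorusBundle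

/-! ### Resolvents, self-adjointness criteria and restriction to invariant subspaces -/

section Operators

variable {H : Type*} [NormedAddCommGroup H] [InnerProductSpace ℂ H]

/-! Everything is compared with the restriction of D to H₀. Since D commutes with the resolvents of
the δ_j, both D and its own resolvents preserve H₀ (`StronglyCommutes.apply_mem_kernel`,
`StronglyCommutes.resolvent_mem_kernel`), so D restricts to a self-adjoint operator with compact
resolvent there. As Γ also preserves H₀, so does D_h.

On H₀ the vertical part vanishes, so D = D_h + Z on H₀ ∩ dom D, which is also the domain of D₀
(`exists_D_eq`, `baseDirac_domain`). Thus D₀ is a symmetric operator differing from the restricted D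
by a bounded one; self-adjointness and compactness of the resolvent survive such a perturbation
(`isSelfAdjoint_of_eq_add`, `hasCompactResolvent_of_eq_add`).

Because Z commutes with the algebra, it drops out of commutators: [D₀, b] is [D, b] on H₀
(`exists_commutator_baseDirac`). Boundedness and the first-order condition are therefore inherited,
as is the commutant property, J and the invariant subalgebra both preserving H₀. -/

theorem abs_im_mul_norm_le {T : H →ₗ.[ℂ] H} (hT : T.IsFormalAdjoint T) (z : ℂ) (x : T.domain) :
    |z.im| * ‖(x : H)‖ ≤ ‖T x - z • (x : H)‖ := by
  -- Symmetry makes ⟨x, Tx⟩ real, so only z contributes to Im ⟨x, (T - z)x⟩; Cauchy–Schwarz then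
  -- gives the bound.
  have hre : (inner ℂ (x : H) (T x)).im = 0 := by
    have h := hT x x
    rw [← inner_conj_symm] at h
    exact Complex.conj_eq_iff_im.mp h
  have him : (inner ℂ (x : H) (T x - z • (x : H))).im = -(z.im * ‖(x : H)‖ ^ 2) := by
    rw [inner_sub_right, inner_smul_right, inner_self_eq_norm_sq_to_K, Complex.sub_im, hre,
      zero_sub, ← RCLike.ofReal_pow]
    change -(z * ((‖(x : H)‖ ^ 2 : ℝ) : ℂ)).im = _
    rw [Complex.im_mul_ofReal]
  have h1 : |z.im| * ‖(x : H)‖ ^ 2 ≤ ‖(x : H)‖ * ‖T x - z • (x : H)‖ := by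
    refine le_trans (le_of_eq ?_)
      ((Complex.abs_im_le_norm _).trans (norm_inner_le_norm (x : H) (T x - z • (x : H))))
    rw [him, abs_neg, abs_mul, abs_of_nonneg (sq_nonneg ‖(x : H)‖)]
  rcases (norm_nonneg (x : H)).eq_or_lt with h0 | h0
  · rw [← h0, mul_zero]
    exact norm_nonneg _
  · nlinarith

/-- The map `T - z : dom T → H`. -/
def subSMul (T : H →ₗ.[ℂ] H) (z : ℂ) : T.domain →ₗ[ℂ] H :=
  T.toFun - z • T.domain.subtype

theorem subSMul_apply (T : H →ₗ.[ℂ] H) (z : ℂ) (x : T.domain) :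
    subSMul T z x = T x - z • (x : H) := rfl

theorem subSMul_injective {T : H →ₗ.[ℂ] H} (hT : T.IsFormalAdjoint T) {z : ℂ} (hz : z.im ≠ 0) :
    Function.Injective (subSMul T z) := by
  rw [injective_iff_map_eq_zero]
  intro x hx
  have h := abs_im_mul_norm_le hT z x
  rw [← subSMul_apply, hx, norm_zero] at h
  have : ‖(x : H)‖ = 0 := by
    have := abs_pos.mpr hz
    nlinarith [norm_nonneg (x : H)]
  exact Subtype.ext (norm_eq_zero.mp this)

/-- The restriction of an unbounded operator to an invariant subspace. -/
def restriction (K : Submodule ℂ H) (T : H →ₗ.[ℂ] H)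
    (hK : ∀ x : T.domain, (x : H) ∈ K → T x ∈ K) : K →ₗ.[ℂ] K where
  domain := T.domain.comap K.subtype
  toFun :=
    { toFun := fun x => ⟨T ⟨x, x.2⟩, hK _ x.1.2⟩
      map_add' := fun x y => Subtype.ext (T.map_add ⟨x, x.2⟩ ⟨y, y.2⟩)
      map_smul' := fun c x => Subtype.ext (T.map_smul c ⟨x, x.2⟩) }

theorem isRestriction_restriction (K : Submodule ℂ H) (T : H →ₗ.[ℂ] H)
    (hK : ∀ x : T.domain, (x : H) ∈ K → T x ∈ K) : IsRestriction K T (restriction K T hK) :=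
  ⟨fun _ => Iff.rfl, fun _ _ => rfl⟩

variable {K : Submodule ℂ H} {T : H →ₗ.[ℂ] H}

theorem isFormalAdjoint_restriction (hT : T.IsFormalAdjoint T)
    (hK : ∀ x : T.domain, (x : H) ∈ K → T x ∈ K) :
    (restriction K T hK).IsFormalAdjoint (restriction K T hK) :=
  fun x y => hT ⟨x, x.2⟩ ⟨y, y.2⟩

/-- The resolvent restricts to the resolvent, and a compact operator stays compact on a closed
invariant subspace. -/
theorem hasCompactResolvent_restriction [CompleteSpace K] (hT : HasCompactResolvent T)
    (hK : ∀ x : T.domain, (x : H) ∈ K → T x ∈ K)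
    (hR : ∀ (z : ℂ) (R : H →L[ℂ] H), z.im ≠ 0 → IsResolventAt T z R → ∀ x ∈ K, R x ∈ K) :
    HasCompactResolvent (restriction K T hK) := by
  intro z hz
  obtain ⟨R, hR', hRc⟩ := hT z hz
  have hRK := hR z R hz hR'
  refine ⟨R.restrict hRK, ⟨fun x => ?_, fun y => Subtype.ext (hR'.2 ⟨y, y.2⟩)⟩, ?_⟩
  · obtain ⟨h1, h2⟩ := hR'.1 x
    exact ⟨h1, Subtype.ext h2⟩
  · exact IsCompactOperator.restrict' (f := (R : H →ₗ[ℂ] H)) hRc hRK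

/-- The value 0 of T corresponds to the value (0 - i)⁻¹ = i of its resolvent. This turns kernels of
unbounded operators into eigenspaces of bounded ones, to which strong commutation applies. -/
theorem mem_kernel_iff {R : H →L[ℂ] H} (hR : IsResolventAt T Complex.I R) (x : H) :
    x ∈ kernel T ↔ R x = Complex.I • x := by
  constructor
  · rintro ⟨hx, h0⟩
    have h := hR.2 ⟨x, hx⟩
    rw [h0, zero_sub, map_neg, map_smul] at h
    replace h : -(Complex.I • R x) = x := h
    have h2 := congrArg (Complex.I • ·) h
    simpa [smul_smul] using h2
  · intro h
    obtain ⟨h1, h2⟩ := hR.1 x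
    have hx : x ∈ T.domain := by
      have := T.domain.smul_mem (-Complex.I) h1
      simpa [h, smul_smul] using this
    refine ⟨hx, ?_⟩
    have h3 : T ⟨R x, h1⟩ = Complex.I • T ⟨x, hx⟩ := by
      rw [← T.map_smul]
      congr 1
      exact Subtype.ext h
    rw [h3, h, smul_smul, Complex.I_mul_I, neg_one_smul, sub_neg_eq_add, add_eq_right] at h2
    exact (smul_eq_zero.mp h2).resolve_left Complex.I_ne_zero

variable [CompleteSpace H]

theorem isFormalAdjoint_of_isSelfAdjoint {T : H →ₗ.[ℂ] H} (hT : IsSelfAdjoint T) :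
    T.IsFormalAdjoint T := by
  have h := LinearPMap.adjoint_isFormalAdjoint hT.dense_domain
  rwa [LinearPMap.isSelfAdjoint_def.mp hT] at h

/-- The graph of T is complete, and T - z, viewed as a bounded map on it, is bounded below. -/
theorem isClosed_range_subSMul {T : H →ₗ.[ℂ] H} (hT : IsSelfAdjoint T) {z : ℂ} (hz : z.im ≠ 0) :
    IsClosed ((subSMul T z).range : Set H) := by
  have hs := isFormalAdjoint_of_isSelfAdjoint hT
  have hcl : IsClosed (T.graph : Set (H × H)) := hT.isClosed
  have : CompleteSpace T.graph := hcl.completeSpace_coe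
  let f : T.graph →L[ℂ] H :=
    ((ContinuousLinearMap.snd ℂ H H) - z • (ContinuousLinearMap.fst ℂ H H)).comp T.graph.subtypeL
  have hpos := abs_pos.mpr hz
  -- The graph carries the sup norm; the constant exceeds both the bound 1/|Im z| for x and the
  -- bound 1 + |z|/|Im z| for Tx.
  have hf : AntilipschitzWith (Real.toNNReal (1 + (1 + ‖z‖) / |z.im|)) f := by
    refine AddMonoidHomClass.antilipschitz_of_bound f fun p => ?_
    obtain ⟨x, hx1, hx2⟩ := LinearPMap.mem_graph_iff T |>.mp p.2
    rw [Real.coe_toNNReal _ (by positivity)]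
    have hfp : f p = T x - z • (x : H) := by
      rw [hx1, hx2]
      rfl
    have h1 := abs_im_mul_norm_le hs z x
    rw [← hfp] at h1
    have h1' : ‖(x : H)‖ ≤ ‖f p‖ / |z.im| := by
      rw [le_div_iff₀ hpos]
      linarith
    have h2 : ‖T x‖ ≤ ‖f p‖ + ‖z‖ * ‖(x : H)‖ := by
      have : T x = f p + z • (x : H) := by rw [hfp]; abel
      calc ‖T x‖ = ‖f p + z • (x : H)‖ := by rw [← this]
        _ ≤ _ := by
          rw [← norm_smul]
          exact norm_add_le _ _
    have hz0 := norm_nonneg z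
    have h3 : (1 + (1 + ‖z‖) / |z.im|) * ‖f p‖ =
        ‖f p‖ + ‖z‖ * (‖f p‖ / |z.im|) + ‖f p‖ / |z.im| := by ring
    have h4 := mul_le_mul_of_nonneg_left h1' hz0
    have h5 : 0 ≤ ‖z‖ * (‖f p‖ / |z.im|) := by positivity
    have h6 : 0 ≤ ‖f p‖ / |z.im| := by positivity
    rw [h3]
    refine max_le ?_ ?_
    · change ‖(p : H × H).1‖ ≤ _
      rw [← hx1]
      linarith [norm_nonneg (f p)]
    · change ‖(p : H × H).2‖ ≤ _
      rw [← hx2]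
      linarith
  have hrange : ((subSMul T z).range : Set H) = Set.range f := by
    ext y
    constructor
    · rintro ⟨x, rfl⟩
      exact ⟨⟨((x : H), T x), T.mem_graph x⟩, rfl⟩
    · rintro ⟨p, rfl⟩
      obtain ⟨x, hx1, hx2⟩ := LinearPMap.mem_graph_iff T |>.mp p.2
      refine ⟨x, ?_⟩
      rw [subSMul_apply, hx1, hx2]
      rfl
  rw [hrange]
  exact hf.isClosed_range f.uniformContinuous

theorem subSMul_surjective {T : H →ₗ.[ℂ] H} (hT : IsSelfAdjoint T) {z : ℂ} (hz : z.im ≠ 0) :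
    Function.Surjective (subSMul T z) := by
  have hs := isFormalAdjoint_of_isSelfAdjoint hT
  have hcl := isClosed_range_subSMul hT hz
  have : CompleteSpace (subSMul T z).range := hcl.completeSpace_coe
  rw [← LinearMap.range_eq_top, ← Submodule.orthogonal_eq_bot_iff, Submodule.eq_bot_iff]
  intro y hy
  -- A vector orthogonal to the range is an eigenvector of the adjoint, hence of T, for the non-real
  -- value conj z, so it is zero.
  have hy' : ∀ x : T.domain, inner ℂ (conj z • y) (x : H) = inner ℂ y (T x) := by
    intro x
    have h := (Submodule.mem_orthogonal' _ _).mp hy _ ⟨x, rfl⟩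
    rw [subSMul_apply, inner_sub_right, sub_eq_zero, inner_smul_right] at h
    rw [inner_smul_left, Complex.conj_conj, h]
  have hmem : y ∈ T.adjoint.domain := LinearPMap.mem_adjoint_domain_of_exists y ⟨_, hy'⟩
  have happ := LinearPMap.adjoint_apply_eq hT.dense_domain ⟨y, hmem⟩ hy'
  -- Stated for a variable S because the domain proof depends on the operator, which blocks
  -- rewriting the adjoint to T directly.
  have hker : ∀ S : H →ₗ.[ℂ] H, S = T → ∀ h : y ∈ S.domain, S ⟨y, h⟩ = conj z • y → y = 0 := by
    rintro S rfl h hS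
    have hz' : (conj z).im ≠ 0 := by simpa using hz
    have := subSMul_injective hs hz' (a₁ := ⟨y, h⟩) (a₂ := 0)
      (by rw [subSMul_apply, hS, map_zero, sub_self])
    exact congrArg Subtype.val this
  exact hker _ (LinearPMap.isSelfAdjoint_def.mp hT) hmem happ

theorem exists_isResolventAt {T : H →ₗ.[ℂ] H} (hT : IsSelfAdjoint T) {z : ℂ} (hz : z.im ≠ 0) :
    ∃ R : H →L[ℂ] H, IsResolventAt T z R := by
  have hs := isFormalAdjoint_of_isSelfAdjoint hT
  let e := LinearEquiv.ofBijective (subSMul T z) ⟨subSMul_injective hs hz, subSMul_surjective hT hz⟩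
  have he : ∀ x, T (e.symm x) - z • (e.symm x : H) = x := fun x => e.apply_symm_apply x
  refine ⟨(T.domain.subtype ∘ₗ e.symm.toLinearMap).mkContinuous (1 / |z.im|) fun x => ?_,
    fun x => ⟨(e.symm x).2, he x⟩, fun y => congrArg Subtype.val (e.symm_apply_apply y)⟩
  have h := abs_im_mul_norm_le hs z (e.symm x)
  rw [he] at h
  rw [one_div, ← div_eq_inv_mul, le_div_iff₀ (abs_pos.mpr hz), mul_comm]
  exact h

/-- A symmetric operator `T` for which `T - z` is surjective at `z = ± i` is self-adjoint. -/
theorem isSelfAdjoint_of_surjective {T : H →ₗ.[ℂ] H} (hT : T.IsFormalAdjoint T)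
    (h : ∀ z : ℂ, z.im ≠ 0 → Function.Surjective (subSMul T z)) : IsSelfAdjoint T := by
  have hI : Complex.I.im ≠ 0 := by simp
  have hI' : (-Complex.I).im ≠ 0 := by simp
  have hd : Dense (T.domain : Set H) := by
    rw [Submodule.dense_iff_topologicalClosure_eq_top, Submodule.topologicalClosure_eq_top_iff,
      Submodule.eq_bot_iff]
    intro y hy
    -- A vector orthogonal to the domain is (T - i)x; pairing it with x itself forces ‖x‖ = 0.
    obtain ⟨x, rfl⟩ := h _ hI y
    have h0 := (Submodule.mem_orthogonal _ _).mp hy _ x.2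
    have him : (inner ℂ (x : H) (T x)).im = 0 := by
      have h := hT x x
      rw [← inner_conj_symm] at h
      exact Complex.conj_eq_iff_im.mp h
    rw [subSMul_apply, inner_sub_right, inner_smul_right] at h0
    have h1 := congrArg Complex.im h0
    rw [Complex.sub_im, him, inner_self_eq_norm_sq_to_K, ← RCLike.ofReal_pow] at h1
    have h2 : ‖(x : H)‖ = 0 := by simpa [Complex.mul_im, ← Complex.ofReal_pow] using h1
    have h3 : x = 0 := Subtype.ext (norm_eq_zero.mp h2)
    rw [h3, map_zero]
  have hle : T ≤ T.adjoint := hT.le_adjoint hd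
  refine LinearPMap.isSelfAdjoint_def.mpr (LinearPMap.eq_of_le_of_domain_eq hle ?_).symm
  refine le_antisymm hle.1 fun y hy => ?_
  -- With this x, y - x is an eigenvector of the adjoint for i. Writing it as (T + i)u shows that it
  -- is orthogonal to itself.
  obtain ⟨x, hx⟩ := h _ hI (T.adjoint ⟨y, hy⟩ - Complex.I • y)
  have hkey : y - x = 0 := by
    obtain ⟨u, hu⟩ := h _ hI' (y - x)
    rw [subSMul_apply] at hu hx
    have h1 := LinearPMap.adjoint_isFormalAdjoint hd ⟨y, hy⟩ u
    have h2 := hT x u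
    have h3 : T.adjoint ⟨y, hy⟩ - T x = Complex.I • (y - x) := by
      rw [sub_eq_iff_eq_add] at hx
      rw [hx, smul_sub]
      abel
    rw [← inner_self_eq_zero (𝕜 := ℂ)]
    nth_rewrite 2 [← hu]
    rw [inner_sub_right, inner_sub_left, ← h1, ← h2, ← inner_sub_left, h3, inner_smul_left,
      inner_smul_right]
    simp
  rw [sub_eq_zero.mp hkey]
  exact x.2

/-- A symmetric operator that differs from a self-adjoint one by a bounded operator is
self-adjoint. -/
theorem isSelfAdjoint_of_eq_add {S T : H →ₗ.[ℂ] H} (hS : IsSelfAdjoint S)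
    (hT : T.IsFormalAdjoint T) (hdom : T.domain = S.domain) (B : H →L[ℂ] H)
    (h : ∀ (x : H) (hx : x ∈ S.domain) (hx' : x ∈ T.domain), S ⟨x, hx⟩ = T ⟨x, hx'⟩ + B x) :
    IsSelfAdjoint T := by
  have hd : Dense (T.domain : Set H) := hdom ▸ hS.dense_domain
  have hle : T ≤ T.adjoint := hT.le_adjoint hd
  refine LinearPMap.isSelfAdjoint_def.mpr (LinearPMap.eq_of_le_of_domain_eq hle ?_).symm
  refine le_antisymm hle.1 fun y hy => ?_
  have hy' : y ∈ S.adjoint.domain := by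
    -- As S = T + B, the adjoint of S must send y to T*y + B*y; this puts y in dom S* = dom S = dom
    -- T.
    refine LinearPMap.mem_adjoint_domain_of_exists y
      ⟨T.adjoint ⟨y, hy⟩ + ContinuousLinearMap.adjoint B y, fun x => ?_⟩
    have hx : (x : H) ∈ T.domain := by
      rw [hdom]
      exact x.2
    rw [h x x.2 hx, inner_add_left, inner_add_right, ContinuousLinearMap.adjoint_inner_left,
      LinearPMap.adjoint_isFormalAdjoint hd ⟨y, hy⟩ ⟨x, hx⟩]
  rw [LinearPMap.isSelfAdjoint_def.mp hS] at hy'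
  rwa [hdom]

/-- Compactness of the resolvent is stable under bounded perturbations. -/
theorem hasCompactResolvent_of_eq_add {S T : H →ₗ.[ℂ] H} (hS : HasCompactResolvent S)
    (hT : IsSelfAdjoint T) (hdom : T.domain = S.domain) (B : H →L[ℂ] H)
    (h : ∀ (x : H) (hx : x ∈ S.domain) (hx' : x ∈ T.domain), S ⟨x, hx⟩ = T ⟨x, hx'⟩ + B x) :
    HasCompactResolvent T := by
  intro z hz
  obtain ⟨R, hR, hRc⟩ := hS z hz
  obtain ⟨Q, hQ⟩ := exists_isResolventAt hT hz
  refine ⟨Q, hQ, ?_⟩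
  -- Second resolvent identity: Q is a compact operator composed with a bounded one.
  have hQR : Q = R.comp (1 + B.comp Q) := by
    ext x
    obtain ⟨hx, hx'⟩ := hQ.1 x
    have hxS : Q x ∈ S.domain := by
      rw [← hdom]
      exact hx
    have h1 := hR.2 ⟨Q x, hxS⟩
    rw [h _ _ hx] at h1
    have h2 : T ⟨Q x, hx⟩ + B (Q x) - z • Q x = x + B (Q x) := by
      nth_rewrite 4 [← hx']
      abel
    rw [h2] at h1
    exact h1.symm
  rw [hQR]
  exact hRc.comp_clm _

/-- Invariance under T gives only symmetry; invariance under the resolvents supplies surjectivity of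
T - z on K. -/
theorem isSelfAdjoint_restriction [CompleteSpace K] (hT : IsSelfAdjoint T)
    (hK : ∀ x : T.domain, (x : H) ∈ K → T x ∈ K)
    (hR : ∀ (z : ℂ) (R : H →L[ℂ] H), z.im ≠ 0 → IsResolventAt T z R → ∀ x ∈ K, R x ∈ K) :
    IsSelfAdjoint (restriction K T hK) := by
  refine isSelfAdjoint_of_surjective
    (isFormalAdjoint_restriction (isFormalAdjoint_of_isSelfAdjoint hT) hK) fun z hz x => ?_
  obtain ⟨R, hR'⟩ := exists_isResolventAt hT hz
  obtain ⟨h1, h2⟩ := hR'.1 x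
  exact ⟨⟨⟨R x, hR z R hz hR' x x.2⟩, h1⟩, Subtype.ext h2⟩

theorem StronglyCommutes.apply_mem_kernel {D : H →ₗ.[ℂ] H} (h : StronglyCommutes D T)
    (hT : IsSelfAdjoint T) (x : D.domain) (hx : (x : H) ∈ kernel T) : D x ∈ kernel T := by
  obtain ⟨R, hR⟩ := exists_isResolventAt hT (z := Complex.I) (by simp)
  rw [mem_kernel_iff hR] at hx ⊢
  obtain ⟨h1, h2⟩ := h _ R (by simp) hR x
  rw [one_smul] at h2
  rw [← h2, ← D.map_smul]
  congr 1
  exact Subtype.ext hx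

theorem StronglyCommutes.resolvent_mem_kernel {D : H →ₗ.[ℂ] H} (h : StronglyCommutes D T)
    (hT : IsSelfAdjoint T) {z : ℂ} {Q : H →L[ℂ] H} (hQ : IsResolventAt D z Q) {x : H}
    (hx : x ∈ kernel T) : Q x ∈ kernel T := by
  obtain ⟨R, hR⟩ := exists_isResolventAt hT (z := Complex.I) (by simp)
  rw [mem_kernel_iff hR] at hx ⊢
  obtain ⟨h0, h0'⟩ := hQ.1 x
  obtain ⟨h1, h2⟩ := h _ R (by simp) hR ⟨Q x, h0⟩
  -- The two resolvents commute: applying Q to (D - z)RQx = Rx gives RQx = QRx.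
  have h3 := hQ.2 ⟨R (Q x), h1⟩
  rw [h2, one_smul] at h3
  replace h3 : Q (R (D ⟨Q x, h0⟩) - z • R (Q x)) = R (Q x) := h3
  rw [← map_smul, ← map_sub, h0', hx, map_smul] at h3
  exact h3.symm

end Operators

/-! ### The horizontal operator as a symmetric operator -/

section Horizontal

variable {H : Type*} [NormedAddCommGroup H] [InnerProductSpace ℂ H]

theorem horizontalOperator_apply {n : ℕ} {D : H →ₗ.[ℂ] H} {Γ : H →L[ℂ] H} (hΓ : Γ * Γ = 1) {x : H}
    (hx : x ∈ D.domain) (hΓx : Γ x ∈ D.domain) :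
    horizontalOperator n D Γ ⟨x, hx, hΓx⟩ =
      (1 / 2 : ℂ) • (D ⟨x, hx⟩ + (-1 : ℂ) ^ n • Γ (D ⟨Γ x, hΓx⟩)) := by
  have hsq : ∀ y, Γ (Γ y) = y := fun y => DFunLike.congr_fun hΓ y
  change (1 / 2 : ℂ) • Γ (Γ (D ⟨x, hx⟩) + (-1 : ℂ) ^ n • D ⟨Γ x, hΓx⟩) = _
  rw [map_add, map_smul, hsq]

/-- The operator is ½(D ± ΓDΓ) with a real sign, and ΓDΓ is symmetric along with D. -/
theorem isFormalAdjoint_horizontalOperator [CompleteSpace H] {n : ℕ} {D : H →ₗ.[ℂ] H}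
    (hD : D.IsFormalAdjoint D) {Γ : H →L[ℂ] H} (hΓ : Γ * Γ = 1) (hΓs : IsSelfAdjoint Γ) :
    (horizontalOperator n D Γ).IsFormalAdjoint (horizontalOperator n D Γ) := by
  rintro ⟨x, hx, hΓx⟩ ⟨y, hy, hΓy⟩
  have hsym : ∀ u v : H, inner ℂ (Γ u) v = inner ℂ u (Γ v) := hΓs.isSymmetric
  rw [horizontalOperator_apply hΓ hx hΓx, horizontalOperator_apply hΓ hy hΓy]
  have h1 := hD ⟨x, hx⟩ ⟨y, hy⟩
  have h2 := hD ⟨Γ x, hΓx⟩ ⟨Γ y, hΓy⟩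
  dsimp only at h1 h2 ⊢
  rw [inner_smul_left, inner_smul_right, inner_add_left, inner_add_right, inner_smul_left,
    inner_smul_right, h1, hsym, h2, hsym]
  simp [Complex.conj_ofNat]

/-- Kept abstract so that D can be substituted away; in the application the summand D_h itself
involves D. -/
theorem exists_apply_eq_of_eq_add {D S T : H →ₗ.[ℂ] H} {Z : H →L[ℂ] H}
    (hD : D = S + T + (Z : H →ₗ[ℂ] H).toPMap ⊤) {x : H} (hx : x ∈ D.domain) :
    ∃ (h₁ : x ∈ S.domain) (h₂ : x ∈ T.domain), D ⟨x, hx⟩ = S ⟨x, h₁⟩ + T ⟨x, h₂⟩ + Z x := by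
  subst hD
  exact ⟨hx.1.1, hx.1.2, rfl⟩

end Horizontal

/-! ### Antiunitaries and the opposite representation -/

section Opposite

variable {A : Type*} [Ring A] [StarRing A] [Algebra ℂ A] [StarModule ℂ A]
variable {H : Type*} [NormedAddCommGroup H] [InnerProductSpace ℂ H]

/-- Polarization: J preserves norms and turns i into -i, which exchanges the two imaginary terms. -/
theorem inner_antiunitary_left (J : H ≃ₗᵢ⋆[ℂ] H) (x y : H) :
    inner ℂ (J x) y = inner ℂ (J.symm y) x := by
  obtain ⟨v, rfl⟩ := J.surjective y
  have h : ∀ c : ℂ, ‖J x + conj c • J v‖ = ‖x + c • v‖ := fun c => by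
    rw [← J.map_smulₛₗ, ← map_add, J.norm_map]
  have h1 : ‖J x + J v‖ = ‖x + v‖ := by simpa using h 1
  have h2 : ‖J x - J v‖ = ‖x - v‖ := by simpa [← sub_eq_add_neg] using h (-1)
  have h3 : ‖J x - Complex.I • J v‖ = ‖x + Complex.I • v‖ := by
    simpa [← sub_eq_add_neg] using h Complex.I
  have h4 : ‖J x + Complex.I • J v‖ = ‖x - Complex.I • v‖ := by
    simpa [← sub_eq_add_neg] using h (-Complex.I)
  rw [J.symm_apply_apply, ← inner_conj_symm v x, inner_eq_sum_norm_sq_div_four (𝕜 := ℂ) (J x),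
    inner_eq_sum_norm_sq_div_four (𝕜 := ℂ) x]
  simp only [RCLike.I_to_complex, h1, h2, h3, h4]
  simp [Complex.conj_ofNat]
  ring

variable [CompleteSpace H]

/-- The `*`-representation `b ↦ J b* J⁻¹` of the opposite algebra. -/
def oppositeRepresentation (π : A →⋆ₐ[ℂ] (H →L[ℂ] H)) (J : H ≃ₗᵢ⋆[ℂ] H) :
    Aᵐᵒᵖ →⋆ₐ[ℂ] (H →L[ℂ] H) where
  toFun b := oppositeAction π J b.unop
  map_one' := by
    ext x
    simp
  map_mul' a b := by
    ext x
    simp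
  map_zero' := by
    ext x
    simp
  map_add' a b := by
    ext x
    simp
  commutes' r := by
    ext x
    simp [Algebra.algebraMap_eq_smul_one, star_smul, J.map_smulₛₗ]
  map_star' a := by
    refine (ContinuousLinearMap.eq_adjoint_iff _ _).mpr fun x y => ?_
    have h : ∀ u v : H, inner ℂ (π a.unop u) v = inner ℂ u (π (star a.unop) v) := fun u v => by
      rw [map_star, ContinuousLinearMap.star_eq_adjoint, ContinuousLinearMap.adjoint_inner_right]
    rw [oppositeAction_apply, oppositeAction_apply, MulOpposite.unop_star, star_star,
      inner_antiunitary_left, ← inner_conj_symm x, inner_antiunitary_left J, inner_conj_symm,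
      ← inner_conj_symm _ (J.symm x), ← h, inner_conj_symm]

end Opposite

/-! ### Restricting representations and antiunitaries -/

section Restrict

variable {A : Type*} [Ring A] [StarRing A] [Algebra ℂ A] [StarModule ℂ A]
variable {H : Type*} [NormedAddCommGroup H] [InnerProductSpace ℂ H] [CompleteSpace H]

/-- The restriction of a `*`-representation to an invariant closed subspace and a
`*`-subalgebra. -/
def restrictRepresentation (π : A →⋆ₐ[ℂ] (H →L[ℂ] H)) (B : StarSubalgebra ℂ A)
    (K : Submodule ℂ H) [CompleteSpace K] (hK : ∀ b ∈ B, ∀ x ∈ K, π b x ∈ K) :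
    B →⋆ₐ[ℂ] (K →L[ℂ] K) where
  toFun b := (π b).restrict (hK b b.2)
  map_one' := by
    ext x
    simp
  map_mul' a b := by
    ext x
    simp
  map_zero' := by
    ext x
    simp
  map_add' a b := by
    ext x
    simp
  commutes' r := by
    ext x
    simp [Algebra.algebraMap_eq_smul_one]
  map_star' a := by
    refine (ContinuousLinearMap.eq_adjoint_iff _ _).mpr fun x y => ?_
    change inner ℂ (π (star (a : A)) x) (y : H) = inner ℂ (x : H) (π a y)
    rw [map_star, ContinuousLinearMap.star_eq_adjoint, ContinuousLinearMap.adjoint_inner_left]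

/-- The restriction of an antiunitary operator to an invariant subspace. -/
def restrictAntiunitary (J : H ≃ₗᵢ⋆[ℂ] H) (K : Submodule ℂ H) (h : ∀ x ∈ K, J x ∈ K)
    (h' : ∀ x ∈ K, J.symm x ∈ K) : K ≃ₗᵢ⋆[ℂ] K where
  toFun x := ⟨J x, h x x.2⟩
  invFun x := ⟨J.symm x, h' x x.2⟩
  map_add' _ _ := Subtype.ext (map_add J _ _)
  map_smul' c _ := Subtype.ext (J.map_smulₛₗ c _)
  left_inv _ := Subtype.ext (J.symm_apply_apply _)
  right_inv _ := Subtype.ext (J.apply_symm_apply _)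
  norm_map' _ := J.norm_map _

end Restrict

/-! ### Invariance of H₀ -/

section Equivariant

variable {A : Type*} [Ring A] [StarRing A] [Algebra ℂ A] {n : ℕ}
variable {𝒜 : (Fin n → ℤ) → Submodule ℂ A} [GradedAlgebra 𝒜]
variable {H : Type*} [NormedAddCommGroup H] [InnerProductSpace ℂ H] [CompleteSpace H]

namespace EquivariantTriple

section

variable {d : ℤ} (T : EquivariantTriple 𝒜 H d)

theorem mem_zeroEigenspace_iff {x : H} :
    x ∈ T.zeroEigenspace ↔ ∀ j, x ∈ kernel (T.δ j) :=
  Submodule.mem_iInf _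

theorem π_mem_zeroEigenspace {a : A} (ha : a ∈ 𝒜 0) {x : H} (hx : x ∈ T.zeroEigenspace) :
    T.π a x ∈ T.zeroEigenspace := by
  rw [mem_zeroEigenspace_iff] at hx ⊢
  intro j
  obtain ⟨h1, h2⟩ := T.δ_leibniz a x (fun i => (hx i).1) j
  refine ⟨h1, ?_⟩
  rw [h2, derivation_of_mem 𝒜 j ha, (hx j).2]
  simp

theorem J_mem_zeroEigenspace {x : H} (hx : x ∈ T.zeroEigenspace) : T.J x ∈ T.zeroEigenspace := by
  rw [mem_zeroEigenspace_iff] at hx ⊢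
  intro j
  obtain ⟨h0, h0'⟩ := hx j
  obtain ⟨h1, h2⟩ := T.δ_J j ⟨x, h0⟩
  refine ⟨h1, ?_⟩
  rwa [h0', map_zero, add_zero] at h2

theorem J_symm_mem_zeroEigenspace {x : H} (hx : x ∈ T.zeroEigenspace) :
    T.J.symm x ∈ T.zeroEigenspace := by
  -- Since ε = ±1, J² = ε gives J⁻¹ = εJ.
  have h : T.J.symm x = signJSq d • T.J x := by
    apply T.J.injective
    rw [T.J.apply_symm_apply, T.J.map_smulₛₗ, T.J_sq, smul_smul]
    unfold signJSq
    split_ifs <;> simp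
  rw [h]
  exact T.zeroEigenspace.smul_mem _ (T.J_mem_zeroEigenspace hx)

theorem D_mem_zeroEigenspace (x : T.D.domain) (hx : (x : H) ∈ T.zeroEigenspace) :
    T.D x ∈ T.zeroEigenspace := by
  rw [mem_zeroEigenspace_iff] at hx ⊢
  exact fun j => (T.δ_D j).apply_mem_kernel (T.δ_isSelfAdjoint j) x (hx j)

theorem resolvent_mem_zeroEigenspace (z : ℂ) (R : H →L[ℂ] H) (hR : IsResolventAt T.D z R) (x : H)
    (hx : x ∈ T.zeroEigenspace) : R x ∈ T.zeroEigenspace := by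
  rw [mem_zeroEigenspace_iff] at hx ⊢
  exact fun j => (T.δ_D j).resolvent_mem_kernel (T.δ_isSelfAdjoint j) hR (hx j)

end

variable {m : ℤ} {T : EquivariantTriple 𝒜 H (n + m)} {Γ : H →L[ℂ] H}

theorem Γ_mem_zeroEigenspace (hΓ : IsProjectable T Γ) {x : H} (hx : x ∈ T.zeroEigenspace) :
    Γ x ∈ T.zeroEigenspace := by
  rw [mem_zeroEigenspace_iff] at hx ⊢
  intro j
  obtain ⟨h0, h0'⟩ := hx j
  obtain ⟨h1, h2⟩ := hΓ.comm_δ j ⟨x, h0⟩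
  refine ⟨h1, ?_⟩
  rw [h2, h0', map_zero, smul_zero]

theorem horizontalDirac_mem_zeroEigenspace (hΓ : IsProjectable T Γ)
    (x : (T.horizontalDirac Γ).domain) (hx : (x : H) ∈ T.zeroEigenspace) :
    T.horizontalDirac Γ x ∈ T.zeroEigenspace := by
  obtain ⟨x, h1, h2⟩ := x
  have hΓx := Γ_mem_zeroEigenspace hΓ hx
  rw [show T.horizontalDirac Γ ⟨x, h1, h2⟩ = _ from horizontalOperator_apply hΓ.sq h1 h2]
  exact T.zeroEigenspace.smul_mem _ (T.zeroEigenspace.add_mem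
    (T.D_mem_zeroEigenspace ⟨x, h1⟩ hx) (T.zeroEigenspace.smul_mem _
      (Γ_mem_zeroEigenspace hΓ (T.D_mem_zeroEigenspace ⟨Γ x, h2⟩ hΓx))))

end EquivariantTriple

end Equivariant

/-! ### The spectral triple on H₀ -/

namespace EquivariantTriple

variable {A : Type*} [Ring A] [StarRing A] [Algebra ℂ A] {n : ℕ}
variable {𝒜 : (Fin n → ℤ) → Submodule ℂ A} [GradedAlgebra 𝒜]
variable {H : Type*} [NormedAddCommGroup H] [InnerProductSpace ℂ H] [CompleteSpace H]
variable {m : ℤ} {T : EquivariantTriple 𝒜 H (n + m)} {Γ : H →L[ℂ] H}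

/-- The restriction of `D` to `H₀`. -/
def invariantDirac {d : ℤ} (T : EquivariantTriple 𝒜 H d) :
    T.zeroEigenspace →ₗ.[ℂ] T.zeroEigenspace :=
  restriction T.zeroEigenspace T.D T.D_mem_zeroEigenspace

/-- The restriction of the horizontal Dirac operator to `H₀`. -/
def baseDirac (hΓ : IsProjectable T Γ) : T.zeroEigenspace →ₗ.[ℂ] T.zeroEigenspace :=
  restriction T.zeroEigenspace (T.horizontalDirac Γ) (horizontalDirac_mem_zeroEigenspace hΓ)

theorem exists_D_eq (hT : HasIsometricFibres T Γ) :
    ∃ Z : H →L[ℂ] H, (∀ a, Commute Z (T.π a)) ∧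
      ∀ x ∈ T.zeroEigenspace, ∀ hx : x ∈ T.D.domain,
        ∃ hx' : x ∈ (T.horizontalDirac Γ).domain,
          T.D ⟨x, hx⟩ = T.horizontalDirac Γ ⟨x, hx'⟩ + Z x := by
  obtain ⟨Dv, Z, _, hD, hv, -, -, hZ, -, -⟩ := hT
  refine ⟨Z, hZ, fun x hx0 hx => ?_⟩
  obtain ⟨h1, h2, h3⟩ := exists_apply_eq_of_eq_add hD hx
  exact ⟨h2, by rw [h3, hv ⟨x, h1⟩ hx0, zero_add]⟩

/-- One inclusion is built into the natural domain of D_h; the other holds because dom D is the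
domain of the sum D_v + D_h + Z. -/
theorem baseDirac_domain (hΓ : IsProjectable T Γ) (hT : HasIsometricFibres T Γ) :
    (baseDirac hΓ).domain = T.invariantDirac.domain := by
  obtain ⟨Z, -, hZ⟩ := exists_D_eq hT
  exact le_antisymm (fun x hx => hx.1) fun x hx => (hZ x x.2 hx).1

theorem exists_invariantDirac_eq (hΓ : IsProjectable T Γ) (hT : HasIsometricFibres T Γ) :
    ∃ B : T.zeroEigenspace →L[ℂ] T.zeroEigenspace,
      ∀ (x : T.zeroEigenspace) (hx : x ∈ T.invariantDirac.domain)
        (hx' : x ∈ (baseDirac hΓ).domain),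
        T.invariantDirac ⟨x, hx⟩ = baseDirac hΓ ⟨x, hx'⟩ + B x := by
  obtain ⟨Z, -, hZ⟩ := exists_D_eq hT
  -- Compressing Z to H₀ avoids showing that Z preserves H₀: on the domain, Zx = Dx - D_h x already
  -- lies there, so the projection changes nothing.
  refine ⟨T.zeroEigenspace.orthogonalProjectionOnto.comp (Z.comp T.zeroEigenspace.subtypeL),
    fun x hx hx' => ?_⟩
  obtain ⟨h1, h2⟩ := hZ x x.2 hx
  have h3 : Z x = ((T.invariantDirac ⟨x, hx⟩ - baseDirac hΓ ⟨x, hx'⟩ : T.zeroEigenspace) : H) :=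
    (sub_eq_of_eq_add' h2).symm
  rw [← sub_eq_iff_eq_add']
  change _ = T.zeroEigenspace.orthogonalProjectionOnto (Z x)
  rw [h3, Submodule.orthogonalProjectionOnto_mem_subspace_eq_self]

theorem isSelfAdjoint_baseDirac (hΓ : IsProjectable T Γ) (hT : HasIsometricFibres T Γ) :
    IsSelfAdjoint (baseDirac hΓ) := by
  obtain ⟨B, hB⟩ := exists_invariantDirac_eq hΓ hT
  refine isSelfAdjoint_of_eq_add (isSelfAdjoint_restriction T.isSelfAdjoint T.D_mem_zeroEigenspace
    fun z R _ => T.resolvent_mem_zeroEigenspace z R)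
    (isFormalAdjoint_restriction ?_ _) (baseDirac_domain hΓ hT) B hB
  exact isFormalAdjoint_horizontalOperator (isFormalAdjoint_of_isSelfAdjoint T.isSelfAdjoint)
    hΓ.sq hΓ.isSelfAdjoint

theorem hasCompactResolvent_baseDirac (hΓ : IsProjectable T Γ) (hT : HasIsometricFibres T Γ) :
    HasCompactResolvent (baseDirac hΓ) := by
  obtain ⟨B, hB⟩ := exists_invariantDirac_eq hΓ hT
  exact hasCompactResolvent_of_eq_add (hasCompactResolvent_restriction T.hasCompactResolvent
    T.D_mem_zeroEigenspace fun z R _ => T.resolvent_mem_zeroEigenspace z R)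
    (isSelfAdjoint_baseDirac hΓ hT) (baseDirac_domain hΓ hT) B hB

/-- On `H₀`, the commutators of `D_h` with the invariant subalgebra are those of `D`. -/
theorem exists_commutator_baseDirac (hΓ : IsProjectable T Γ) (hT : HasIsometricFibres T Γ)
    {a : A} (ha : a ∈ 𝒜 0) {X : H →L[ℂ] H} (hX : IsCommutator T.D (T.π a) X)
    {S : T.zeroEigenspace →L[ℂ] T.zeroEigenspace} (hS : ∀ x, (S x : H) = T.π a x)
    (x : (baseDirac hΓ).domain) :
    ∃ h : S x ∈ (baseDirac hΓ).domain,
      X ((x : T.zeroEigenspace) : H) = (baseDirac hΓ ⟨S x, h⟩ - S (baseDirac hΓ x) :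
        T.zeroEigenspace) := by
  obtain ⟨Z, hZa, hZ⟩ := exists_D_eq hT
  obtain ⟨x, hx⟩ := x
  obtain ⟨h1, h2⟩ := hX ⟨x, hx.1⟩
  obtain ⟨_, h3⟩ := hZ x x.2 hx.1
  obtain ⟨h4, h5⟩ := hZ _ (T.π_mem_zeroEigenspace ha x.2) h1
  have h6 : S x = ⟨T.π a x, T.π_mem_zeroEigenspace ha x.2⟩ := Subtype.ext (hS x)
  have h7 : S x ∈ (baseDirac hΓ).domain := by
    rw [h6]
    exact h4
  refine ⟨h7, ?_⟩
  have h8 : (baseDirac hΓ ⟨S x, h7⟩ : H) = T.horizontalDirac Γ ⟨T.π a x, h4⟩ := by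
    change T.horizontalDirac Γ ⟨(S x : H), _⟩ = _
    congr 1
    exact Subtype.ext (hS x)
  -- This cancels the two Z terms, leaving the commutator of D_h.
  have h9 : Z (T.π a x) = T.π a (Z x) := DFunLike.congr_fun (hZa a).eq (x : H)
  rw [Submodule.coe_sub, hS, h8, h2, h5, h3, map_add, h9]
  change _ = _ - T.π a (T.horizontalDirac Γ ⟨x, hx⟩)
  abel

variable [StarModule ℂ A] [StarCompatible 𝒜]

/-- The spectral triple of the invariant subalgebra on `H₀`. -/
def baseTriple (hΓ : IsProjectable T Γ) (hT : HasIsometricFibres T Γ) :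
    SpectralTriple (invariantSubalgebra 𝒜) T.zeroEigenspace where
  π := restrictRepresentation T.π (invariantSubalgebra 𝒜) T.zeroEigenspace
    fun _ hb _ hx => T.π_mem_zeroEigenspace hb hx
  D := baseDirac hΓ
  isSelfAdjoint := isSelfAdjoint_baseDirac hΓ hT
  hasCompactResolvent := hasCompactResolvent_baseDirac hΓ hT
  bounded_commutator b := by
    obtain ⟨X, hX⟩ := T.bounded_commutator b
    -- The compression of [D, b] agrees with [D, b] on the domain, where its values are in H₀.
    refine ⟨T.zeroEigenspace.orthogonalProjectionOnto.comp (X.comp T.zeroEigenspace.subtypeL),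
      fun x => ?_⟩
    obtain ⟨h1, h2⟩ := exists_commutator_baseDirac hΓ hT b.2 hX
      (S := restrictRepresentation T.π (invariantSubalgebra 𝒜) T.zeroEigenspace
        (fun _ hb _ hx => T.π_mem_zeroEigenspace hb hx) b) (fun _ => rfl) x
    refine ⟨h1, ?_⟩
    change T.zeroEigenspace.orthogonalProjectionOnto (X ((x : T.zeroEigenspace) : H)) = _
    rw [h2, Submodule.orthogonalProjectionOnto_mem_subspace_eq_self]

/-- The restriction of `J` to `H₀`. -/
def baseJ {d : ℤ} (T : EquivariantTriple 𝒜 H d) : T.zeroEigenspace ≃ₗᵢ⋆[ℂ] T.zeroEigenspace :=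
  restrictAntiunitary T.J T.zeroEigenspace (fun _ => T.J_mem_zeroEigenspace)
    fun _ => T.J_symm_mem_zeroEigenspace

theorem commute_baseTriple (hΓ : IsProjectable T Γ) (hT : HasIsometricFibres T Γ)
    (b c : invariantSubalgebra 𝒜) :
    Commute ((baseTriple hΓ hT).π b) (oppositeAction (baseTriple hΓ hT).π T.baseJ c) := by
  ext x
  exact DFunLike.congr_fun (T.commutant b c).eq (x : H)

theorem first_order_baseTriple (hΓ : IsProjectable T Γ) (hT : HasIsometricFibres T Γ)
    (b c : invariantSubalgebra 𝒜) (X : T.zeroEigenspace →L[ℂ] T.zeroEigenspace)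
    (hX : IsCommutator (baseTriple hΓ hT).D ((baseTriple hΓ hT).π b) X) :
    Commute X (oppositeAction (baseTriple hΓ hT).π T.baseJ c) := by
  obtain ⟨Y, hY⟩ := T.bounded_commutator b
  -- Both commutators are bounded and agree on the dense domain of D₀, hence on all of H₀.
  have hXY : ∀ x : T.zeroEigenspace, (X x : H) = Y x := by
    have hd : Dense ((baseDirac hΓ).domain : Set T.zeroEigenspace) :=
      (isSelfAdjoint_baseDirac hΓ hT).dense_domain
    refine fun x => congrFun (Continuous.ext_on (f := fun x => (X x : H))
      (g := fun x : T.zeroEigenspace => Y x) hd (by fun_prop) (by fun_prop) fun y hy => ?_) x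
    obtain ⟨_, h1⟩ := hX ⟨y, hy⟩
    obtain ⟨_, h2⟩ := exists_commutator_baseDirac hΓ hT b.2 hY
      (S := (baseTriple hΓ hT).π b) (fun _ => rfl) ⟨y, hy⟩
    exact (congrArg Subtype.val h1).trans h2.symm
  ext x
  have h := DFunLike.congr_fun (T.first_order b c Y hY).eq (x : H)
  change (X _ : H) = oppositeAction T.π T.J (c : A) (X x)
  rw [hXY, hXY]
  exact h

end EquivariantTriple

end TorusBundle

end

theorem mainTheorem1
    {A : Type*} [Ring A] [StarRing A] [Algebra ℂ A] [StarModule ℂ A]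
    {n : ℕ} (𝒜 : (Fin n → ℤ) → Submodule ℂ A) [GradedAlgebra 𝒜] [TorusBundle.StarCompatible 𝒜]
    {H : Type*} [NormedAddCommGroup H] [InnerProductSpace ℂ H] [CompleteSpace H]
    (m : ℤ) (T : TorusBundle.EquivariantTriple 𝒜 H (n + m)) (Γ : H →L[ℂ] H)
    (hΓ : TorusBundle.IsProjectable T Γ) (hT : TorusBundle.HasIsometricFibres T Γ) :
    ∃ (T₀ : TorusBundle.SpectralTriple (TorusBundle.invariantSubalgebra 𝒜) T.zeroEigenspace)
      (J₀ : T.zeroEigenspace ≃ₗᵢ⋆[ℂ] T.zeroEigenspace)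
      (ρ : (TorusBundle.invariantSubalgebra 𝒜)ᵐᵒᵖ →⋆ₐ[ℂ]
        (T.zeroEigenspace →L[ℂ] T.zeroEigenspace)),
      -- `B` acts on `H₀` by restriction, `D₀` is the restriction of `D_h`, `J₀` that of `J`
      (∀ (b : TorusBundle.invariantSubalgebra 𝒜) (h : T.zeroEigenspace),
        (T₀.π b h : H) = T.π (b : A) (h : H)) ∧
      TorusBundle.IsRestriction T.zeroEigenspace (T.horizontalDirac Γ) T₀.D ∧
      (∀ h : T.zeroEigenspace, (J₀ h : H) = T.J (h : H)) ∧
      -- the action of the opposite algebra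
      (∀ b : TorusBundle.invariantSubalgebra 𝒜,
        ρ (MulOpposite.op b) = TorusBundle.oppositeAction T₀.π J₀ b) ∧
      -- `J₀` maps `B` into its commutant
      (∀ b c : TorusBundle.invariantSubalgebra 𝒜,
        Commute (T₀.π b) (TorusBundle.oppositeAction T₀.π J₀ c)) ∧
      -- the first-order condition
      (∀ (b c : TorusBundle.invariantSubalgebra 𝒜)
        (X : T.zeroEigenspace →L[ℂ] T.zeroEigenspace),
        TorusBundle.IsCommutator T₀.D (T₀.π b) X →
          Commute X (TorusBundle.oppositeAction T₀.π J₀ c)) := by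
  exact ⟨TorusBundle.EquivariantTriple.baseTriple hΓ hT, T.baseJ,
    TorusBundle.oppositeRepresentation (TorusBundle.EquivariantTriple.baseTriple hΓ hT).π T.baseJ,
    fun _ _ => rfl,
    TorusBundle.isRestriction_restriction _ _
      (TorusBundle.EquivariantTriple.horizontalDirac_mem_zeroEigenspace hΓ),
    fun _ => rfl, fun _ => rfl,
    TorusBundle.EquivariantTriple.commute_baseTriple hΓ hT,
    TorusBundle.EquivariantTriple.first_order_baseTriple hΓ hT⟩
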